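/- Let $|\psi\rangle\in\mathbb C^2\otimes\mathbb C^2\otimes\mathbb C^2$ be a unit vector (a pure state of three qubits $A,B,C$), and for distinct $i,j\in\{A,B,C\}$ let $\rho_{ij}$ be the reduced state of $|\psi\rangle\langle\psi|$ on the qubits $i$ and $j$ (in this order), i.e. its partial trace over the third qubit. Let $\sigma_1,\sigma_2,\sigma_3$ be the Pauli matrices, and for a two-qubit state $\rho$ put: - $\mathcal C(\rho)=\max\{0,\lambda_1-\lambda_2-\lambda_3-\lambda_4\}$, the concurrence, where $\lambda_1\ge\lambda_2\ge\lambda_3\ge\lambda_4$ are the square roots of the eigenvalues of $\rho\,(\sigma_2\otimes\sigma_2)\rho^*(\sigma_2\otimes\sigma_2)$, with $\rho^*$ the entrywise complex conjugate in the computational basis; - $S(\rho)=\operatorname{Tr}(T^{T}T)$, where $T=(t_{kl})_{k,l=1}^3$ and $t_{kl}=\operatorname{Tr}[\rho\,(\sigma_k\otimes\sigma_l)]$; - $\rho$ is $F_3$-steerable if it violates the three-setting linear steering inequality, i.e. if there are unit vectors $\hat a_1,\hat a_2,\hat a_3\in\mathbb R^3$ and orthonormal vectors $\hat b_1,\hat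 b_2,\hat b_3\in\mathbb R^3$ with $$\frac1{\sqrt3}\Bigl|\sum_{k=1}^3\operatorname{Tr}\bigl[\rho\,\bigl((\hat a_k\cdot\vec\sigma)\otimes(\hat b_k\cdot\vec\sigma)\bigr)\bigr]\Bigr|>1 .$$ If $\mathcal C(\rho_{ij})^2>\frac49$ for some $i\ne j$, then the corresponding reduced state $\rho_{ij}$ is $F_3$-steerable, and $S(\rho_{ij})>1$. -/

import Mathlib

open scoped Kronecker

noncomputable section

/-- The three Pauli matrices `σ₁, σ₂, σ₃`. -/
def pauli : Fin 3 → Matrix (Fin 2) (Fin 2) ℂ :=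
  ![!![0, 1; 1, 0], !![0, -Complex.I; Complex.I, 0], !![1, 0; 0, -1]]

/-- The spin observable `v · σ` for a direction `v ∈ ℝ³`. -/
def spin (v : EuclideanSpace ℝ (Fin 3)) : Matrix (Fin 2) (Fin 2) ℂ :=
  ∑ i, (v i : ℂ) • pauli i

/-- The density matrix `|ψ⟩⟨ψ|` of a vector `ψ` of `ℂ² ⊗ ℂ² ⊗ ℂ²`; the computational basis is
indexed by the functions from the three parties `A = 0`, `B = 1`, `C = 2` to `{0, 1}`. -/
def pureDensity (ψ : EuclideanSpace ℂ (Fin 3 → Fin 2)) :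
    Matrix (Fin 3 → Fin 2) (Fin 3 → Fin 2) ℂ :=
  Matrix.of fun s t => ψ s * star (ψ t)

/-- The basis label in which party `i` has bit `x.1`, party `j` has bit `x.2` and the remaining
party has bit `c` (for `i ≠ j`). -/
def basisLabel (i j : Fin 3) (x : Fin 2 × Fin 2) (c : Fin 2) : Fin 3 → Fin 2 :=
  fun k => if k = i then x.1 else if k = j then x.2 else c

/-- The reduced state `ρ_ij` of a three-qubit state (for `i ≠ j`): the partial trace over the
remaining party, with party `i` as first and party `j` as second tensor factor. -/
def reducedState (ρ : Matrix (Fin 3 → Fin 2) (Fin 3 → Fin 2) ℂ) (i j : Fin 3) :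
    Matrix (Fin 2 × Fin 2) (Fin 2 × Fin 2) ℂ :=
  Matrix.of fun x y => ∑ c, ρ (basisLabel i j x c) (basisLabel i j y c)

/-- The spin-flipped state `(σ₂ ⊗ σ₂) ρ* (σ₂ ⊗ σ₂)`, where `ρ*` is the entrywise complex
conjugate of `ρ` in the computational basis. -/
def spinFlip (ρ : Matrix (Fin 2 × Fin 2) (Fin 2 × Fin 2) ℂ) :
    Matrix (Fin 2 × Fin 2) (Fin 2 × Fin 2) ℂ :=
  (pauli 1 ⊗ₖ pauli 1) * ρ.map (starRingEnd ℂ) * (pauli 1 ⊗ₖ pauli 1)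

/-- The square roots of the four eigenvalues of `ρ * spinFlip ρ`, with multiplicity and in
decreasing order. For a two-qubit state `ρ` these eigenvalues are real and nonnegative. -/
def woottersValues (ρ : Matrix (Fin 2 × Fin 2) (Fin 2 × Fin 2) ℂ) : List ℝ :=
  ((ρ * spinFlip ρ).charpoly.roots.map fun z => Real.sqrt z.re).sort (· ≥ ·)

/-- The (Wootters) concurrence `max {0, λ₁ - λ₂ - λ₃ - λ₄}` of a two-qubit state. The list of the
`λ`s has exactly four entries, so the default value of `List.getD` is never used. -/
def concurrence (ρ : Matrix (Fin 2 × Fin 2) (Fin 2 × Fin 2) ℂ) : ℝ :=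
  max 0 ((woottersValues ρ).getD 0 0 - (woottersValues ρ).getD 1 0
    - (woottersValues ρ).getD 2 0 - (woottersValues ρ).getD 3 0)

/-- The `n`-setting linear steering functional
`F_n(ρ, μ) = (1 / √n) |∑ k, ⟨(a k · σ) ⊗ (b k · σ)⟩|` with `⟨X⟩ = Tr (ρ X)`. -/
def steeringF {n : ℕ} (ρ : Matrix (Fin 2 × Fin 2) (Fin 2 × Fin 2) ℂ)
    (a b : Fin n → EuclideanSpace ℝ (Fin 3)) : ℝ :=
  1 / Real.sqrt n * ‖∑ k, (ρ * (spin (a k) ⊗ₖ spin (b k))).trace‖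

/-- A two-qubit state is `F₃`-steerable (from the first to the second party) if it violates the
three-setting linear steering inequality `F₃ ≤ 1` for some unit vectors `a k` and some orthonormal
vectors `b k`. -/
def IsF3Steerable (ρ : Matrix (Fin 2 × Fin 2) (Fin 2 × Fin 2) ℂ) : Prop :=
  ∃ a b : Fin 3 → EuclideanSpace ℝ (Fin 3),
    (∀ k, ‖a k‖ = 1) ∧ Orthonormal ℝ b ∧ 1 < steeringF ρ a b

/-- The correlation matrix `t_kl = Tr (ρ (σ_k ⊗ σ_l))`, which is real for Hermitian `ρ`. -/
def correlationMatrix (ρ : Matrix (Fin 2 × Fin 2) (Fin 2 × Fin 2) ℂ) :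
    Matrix (Fin 3) (Fin 3) ℝ :=
  Matrix.of fun k l => (ρ * (pauli k ⊗ₖ pauli l)).trace.re

/-- `S = Tr (Tᵀ T)` for the correlation matrix `T`. -/
def steeringS (ρ : Matrix (Fin 2 × Fin 2) (Fin 2 × Fin 2) ℂ) : ℝ :=
  ((correlationMatrix ρ).transpose * correlationMatrix ρ).trace

end

open scoped RealInnerProductSpace

/-! Write `ρ_ij = V * Vᴴ`, the columns of `V` being the vectors left by the two basis states of the
third qubit. Let `τ` be `tangleMatrix V`, `t` its squared Hilbert-Schmidt norm, `δ = |det τ|` and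
`G` the Gram determinant of the columns. Then `S = 1 + 2t - 4G` (`steeringS_mul_conjTranspose`) and
`C² = t - 2δ` (`concurrence_mul_conjTranspose_sq`). By Coffman-Kundu-Wootters, `4G - 4δ` is the sum
of the other two squared concurrences, and `sum_sq_concurrences_le` bounds all three by `4/3`. Hence
`S ≥ 3C² - 1/3 > 1`. Finally `S > 1` gives steerability: some orthonormal `b k` have equal `‖T (b
k)‖`, and `a k` parallel to `T (b k)` yields `F₃ = √S`. -/

/-! ### Factorization of the reduced state and the formula for `S`. -/

theorem reducedState_pureDensity (ψ : EuclideanSpace ℂ (Fin 3 → Fin 2)) (i j : Fin 3) :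
    reducedState (pureDensity ψ) i j =
      (Matrix.of fun x c => ψ (basisLabel i j x c) : Matrix (Fin 2 × Fin 2) (Fin 2) ℂ) *
        (Matrix.of fun x c => ψ (basisLabel i j x c)).conjTranspose := by
  ext x y
  simp [reducedState, pureDensity, Matrix.mul_apply]

/-- The squared norm of the column `c`. -/
def colNormSq (V : Matrix (Fin 2 × Fin 2) (Fin 2) ℂ) (c : Fin 2) : ℝ :=
  ∑ x, Complex.normSq (V x c)

/-- The Hermitian inner product of the two columns. -/
def colInner (V : Matrix (Fin 2 × Fin 2) (Fin 2) ℂ) : ℂ :=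
  ∑ x, star (V x 0) * V x 1

/-- The symmetric matrix of spin-flip overlaps of the columns. -/
def tangleMatrix (V : Matrix (Fin 2 × Fin 2) (Fin 2) ℂ) : Matrix (Fin 2) (Fin 2) ℂ :=
  V.transpose * (pauli 1 ⊗ₖ pauli 1) * V

theorem tangleMatrix_apply (V : Matrix (Fin 2 × Fin 2) (Fin 2) ℂ) (c d : Fin 2) :
    tangleMatrix V c d = V (0, 1) c * V (1, 0) d + V (1, 0) c * V (0, 1) d
      - V (0, 0) c * V (1, 1) d - V (1, 1) c * V (0, 0) d := by
  simp [tangleMatrix, Matrix.mul_apply, Fintype.sum_prod_type, pauli, Matrix.kroneckerMap_apply]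
  ring

theorem sum_colNormSq_basisLabel (ψ : EuclideanSpace ℂ (Fin 3 → Fin 2)) (hψ : ‖ψ‖ = 1)
    {i j : Fin 3} (hij : i ≠ j) :
    colNormSq (Matrix.of fun x c => ψ (basisLabel i j x c)) 0 +
      colNormSq (Matrix.of fun x c => ψ (basisLabel i j x c)) 1 = 1 := by
  have h : ∑ s, ‖ψ s‖ ^ 2 = 1 := by
    rw [← EuclideanSpace.norm_sq_eq, hψ, one_pow]
  have hb : Function.Bijective
      (fun p : (Fin 2 × Fin 2) × Fin 2 => basisLabel i j p.1 p.2) := by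
    revert i j
    decide
  rw [← hb.sum_comp (fun s => ‖ψ s‖ ^ 2), Fintype.sum_prod_type_right] at h
  simpa [colNormSq, Complex.normSq_eq_norm_sq] using h

/-- In `Tr ρ² + Tr (ρ * spinFlip ρ)` the local Bloch vectors cancel, leaving `((Tr ρ)² + S) / 2`;
the first trace is `(Tr ρ)² - 2G`, the second is `t`. -/
theorem steeringS_mul_conjTranspose (V : Matrix (Fin 2 × Fin 2) (Fin 2) ℂ) :
    steeringS (V * V.conjTranspose) +
        4 * (colNormSq V 0 * colNormSq V 1 - Complex.normSq (colInner V)) =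
      (colNormSq V 0 + colNormSq V 1) ^ 2 +
        2 * ∑ c, ∑ d, Complex.normSq (tangleMatrix V c d) := by
  simp only [tangleMatrix_apply]
  simp [steeringS, correlationMatrix, Matrix.trace, Matrix.mul_apply, Fintype.sum_prod_type,
    Fin.sum_univ_three, pauli, colNormSq, colInner, Complex.normSq_apply]
  ring

theorem tangleMatrix_comm (V : Matrix (Fin 2 × Fin 2) (Fin 2) ℂ) (c d : Fin 2) :
    tangleMatrix V c d = tangleMatrix V d c := by
  simp only [tangleMatrix_apply]
  ring

/-! ### Concurrence in terms of the tangle matrix. -/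

theorem spinFlip_mul_conjTranspose (V : Matrix (Fin 2 × Fin 2) (Fin 2) ℂ) :
    spinFlip (V * V.conjTranspose) =
      (pauli 1 ⊗ₖ pauli 1) * V.map (starRingEnd ℂ) * V.transpose * (pauli 1 ⊗ₖ pauli 1) := by
  have h : (V * V.conjTranspose).map (starRingEnd ℂ) = V.map (starRingEnd ℂ) * V.transpose := by
    ext x y
    simp [Matrix.mul_apply]
  rw [spinFlip, h]
  simp only [Matrix.mul_assoc]

theorem conjTranspose_mul_pauli_mul_map (V : Matrix (Fin 2 × Fin 2) (Fin 2) ℂ) :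
    V.conjTranspose * (pauli 1 ⊗ₖ pauli 1) * V.map (starRingEnd ℂ) =
      (tangleMatrix V).map (starRingEnd ℂ) := by
  ext c d
  rw [Matrix.map_apply, tangleMatrix_apply]
  simp [Matrix.mul_apply, Fintype.sum_prod_type, pauli, Matrix.kroneckerMap_apply]
  ring

-- Cyclicity: moving the leading `V` to the end turns the 4×4 product into a 2×2 one, at the cost of
-- two zero eigenvalues.
open Polynomial in
theorem charpoly_mul_spinFlip (V : Matrix (Fin 2 × Fin 2) (Fin 2) ℂ) :
    (V * V.conjTranspose * spinFlip (V * V.conjTranspose)).charpoly =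
      X ^ 2 * ((tangleMatrix V).map (starRingEnd ℂ) * tangleMatrix V).charpoly := by
  have h := Matrix.charpoly_mul_comm_of_le V
    ((tangleMatrix V).map (starRingEnd ℂ) * (V.transpose * (pauli 1 ⊗ₖ pauli 1))) (by simp)
  rw [Matrix.mul_assoc (Matrix.map _ _), ← tangleMatrix, ← conjTranspose_mul_pauli_mul_map] at h
  rw [← conjTranspose_mul_pauli_mul_map, spinFlip_mul_conjTranspose]
  simpa [Matrix.mul_assoc] using h

/-- The squared concurrence of a state of rank at most two is the difference of the squared
Hilbert-Schmidt norm and twice the absolute determinant of its tangle matrix. -/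
theorem concurrence_mul_conjTranspose_sq (V : Matrix (Fin 2 × Fin 2) (Fin 2) ℂ) :
    concurrence (V * V.conjTranspose) ^ 2 =
      ∑ c, ∑ d, Complex.normSq (tangleMatrix V c d) - 2 * ‖(tangleMatrix V).det‖ := by
  set t := ∑ c, ∑ d, Complex.normSq (tangleMatrix V c d) with ht
  set δ := ‖(tangleMatrix V).det‖ with hδ
  have hδ0 : 0 ≤ δ := norm_nonneg _
  have htδ : 0 ≤ t - 2 * δ := by
    have h1 : δ ≤ ‖tangleMatrix V 0 0‖ * ‖tangleMatrix V 1 1‖ +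
        ‖tangleMatrix V 0 1‖ * ‖tangleMatrix V 1 0‖ := by
      rw [hδ, Matrix.det_fin_two, ← norm_mul, ← norm_mul]
      exact norm_sub_le _ _
    simp only [ht, Fin.sum_univ_two, Complex.normSq_eq_norm_sq]
    nlinarith [sq_nonneg (‖tangleMatrix V 0 0‖ - ‖tangleMatrix V 1 1‖),
      sq_nonneg (‖tangleMatrix V 0 1‖ - ‖tangleMatrix V 1 0‖)]
  -- `p` and `q` are the sum and difference of the singular values `a ≥ b` of the tangle matrix, as
  -- `a² + b² = t` and `ab = δ`.
  set p := √(t + 2 * δ)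
  set q := √(t - 2 * δ) with hq
  have hp2 : p ^ 2 = t + 2 * δ := Real.sq_sqrt (by linarith)
  have hq2 : q ^ 2 = t - 2 * δ := Real.sq_sqrt htδ
  have hq0 : 0 ≤ q := Real.sqrt_nonneg _
  have hpq : q ≤ p := Real.sqrt_le_sqrt (by linarith)
  set a := (p + q) / 2 with ha
  set b := (p - q) / 2 with hb
  have hb0 : 0 ≤ b := by linarith
  have hab : b ≤ a := by linarith
  have hsum : a ^ 2 + b ^ 2 = t := by
    rw [ha, hb]; linarith
  have hprod : a * b = δ := by
    rw [ha, hb]; linarith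
  have hchar : ((tangleMatrix V).map (starRingEnd ℂ) * tangleMatrix V).charpoly =
      (Polynomial.X - Polynomial.C ((a ^ 2 : ℝ) : ℂ)) *
        (Polynomial.X - Polynomial.C ((b ^ 2 : ℝ) : ℂ)) := by
    have htr : ((tangleMatrix V).map (starRingEnd ℂ) * tangleMatrix V).trace =
        ((a ^ 2 : ℝ) : ℂ) + ((b ^ 2 : ℝ) : ℂ) := by
      rw [← Complex.ofReal_add, hsum, ht]
      simp only [Matrix.trace, Matrix.diag, Matrix.mul_apply, Matrix.map_apply, Complex.ofReal_add,
        Complex.normSq_eq_conj_mul_self, Fin.sum_univ_two, tangleMatrix_comm V 1 0]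
    have hdet : ((tangleMatrix V).map (starRingEnd ℂ) * tangleMatrix V).det =
        ((a ^ 2 : ℝ) : ℂ) * ((b ^ 2 : ℝ) : ℂ) := by
      rw [← Complex.ofReal_mul, ← mul_pow, hprod, hδ, ← Complex.normSq_eq_norm_sq,
        Complex.normSq_eq_conj_mul_self, Matrix.det_mul, RingHom.map_det]
      rfl
    rw [Matrix.charpoly_fin_two, htr, hdet, map_add, map_mul]
    ring
  have hW : woottersValues (V * V.conjTranspose) = [a, b, 0, 0] := by
    have hroots : (V * V.conjTranspose * spinFlip (V * V.conjTranspose)).charpoly.roots =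
        ([((a ^ 2 : ℝ) : ℂ), ((b ^ 2 : ℝ) : ℂ), 0, 0] : List ℂ) := by
      rw [charpoly_mul_spinFlip, hchar]
      have : ([((a ^ 2 : ℝ) : ℂ), ((b ^ 2 : ℝ) : ℂ), 0, 0] : Multiset ℂ) =
        {0, 0, ((a ^ 2 : ℝ) : ℂ), ((b ^ 2 : ℝ) : ℂ)} :=
          Quotient.sound (List.perm_append_comm (l₁ := [((a ^ 2 : ℝ) : ℂ), ((b ^ 2 : ℝ) : ℂ)]))
      refine Eq.trans ?_ ((Polynomial.roots_multiset_prod_X_sub_C _).trans this.symm)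
      congr 1
      simp
      ring
    rw [woottersValues, hroots, Multiset.map_coe, Multiset.coe_sort]
    simp only [List.map_cons, List.map_nil, Complex.ofReal_re, Complex.zero_re, Real.sqrt_zero,
      Real.sqrt_sq hb0, Real.sqrt_sq (hb0.trans hab)]
    exact List.mergeSort_eq_self (· ≥ ·) (by simp [hab, hb0, hb0.trans hab])
  rw [concurrence, hW]
  simp only [List.getD_cons_zero, List.getD_cons_succ, sub_zero]
  rw [max_eq_right (by linarith)]
  rw [← hq2, ha, hb]
  ring

/-! ### Column rotations and the bound `4/3`. -/

/-- A suitable rotation of the two columns makes the first one orthogonal to its spin flip. -/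
theorem exists_tangleMatrix_isotropic (V : Matrix (Fin 2 × Fin 2) (Fin 2) ℂ) :
    ∃ p q : ℂ, Complex.normSq p + Complex.normSq q = 1 ∧
      p ^ 2 * tangleMatrix V 0 0 + 2 * p * q * tangleMatrix V 0 1 +
        q ^ 2 * tangleMatrix V 1 1 = 0 := by
  by_cases h0 : tangleMatrix V 0 0 = 0
  · exact ⟨1, 0, by simp, by simp [h0]⟩
  obtain ⟨s, hs⟩ := IsAlgClosed.exists_pow_nat_eq
    (discrim (tangleMatrix V 0 0) (2 * tangleMatrix V 0 1) (tangleMatrix V 1 1)) two_pos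
  obtain ⟨z, hz⟩ := exists_quadratic_eq_zero h0 ⟨s, by rw [← hs, sq]⟩
  have hr : 0 < Complex.normSq z + 1 := by positivity [Complex.normSq_nonneg z]
  set r : ℝ := (√(Complex.normSq z + 1))⁻¹
  have hr2 : r ^ 2 * (Complex.normSq z + 1) = 1 := by
    rw [inv_pow, Real.sq_sqrt hr.le, inv_mul_cancel₀ hr.ne']
  refine ⟨r * z, r, ?_, ?_⟩
  · simp only [Complex.normSq_mul, Complex.normSq_ofReal]
    linarith
  · linear_combination (r : ℂ) ^ 2 * hz

/-- Rotation of the two columns by the special unitary matrix with first row `p, q`. -/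
def rotateColumns (V : Matrix (Fin 2 × Fin 2) (Fin 2) ℂ) (p q : ℂ) :
    Matrix (Fin 2 × Fin 2) (Fin 2) ℂ :=
  Matrix.of fun x => ![p * V x 0 + q * V x 1, -star q * V x 0 + star p * V x 1]


theorem colNormSq_rotateColumns_add (V : Matrix (Fin 2 × Fin 2) (Fin 2) ℂ) (p q : ℂ) :
    colNormSq (rotateColumns V p q) 0 + colNormSq (rotateColumns V p q) 1 =
      (Complex.normSq p + Complex.normSq q) * (colNormSq V 0 + colNormSq V 1) := by
  simp [colNormSq, rotateColumns, Fintype.sum_prod_type, Complex.normSq_apply]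
  ring

theorem colNormSq_mul_sub_normSq_colInner (V : Matrix (Fin 2 × Fin 2) (Fin 2) ℂ) :
    ((colNormSq V 0 * colNormSq V 1 - Complex.normSq (colInner V) : ℝ) : ℂ) =
      (V.conjTranspose * V).det := by
  simp [Matrix.det_fin_two, Matrix.mul_apply, colNormSq, colInner,
    Complex.normSq_eq_conj_mul_self, mul_comm]

theorem rotateColumns_eq_mul (V : Matrix (Fin 2 × Fin 2) (Fin 2) ℂ) (p q : ℂ) :
    rotateColumns V p q = V * !![p, -star q; q, star p] := by
  ext x c
  fin_cases c <;> simp [rotateColumns, Matrix.mul_apply] <;> ring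

theorem gram_rotateColumns (V : Matrix (Fin 2 × Fin 2) (Fin 2) ℂ) {p q : ℂ}
    (h : Complex.normSq p + Complex.normSq q = 1) :
    colNormSq (rotateColumns V p q) 0 * colNormSq (rotateColumns V p q) 1 -
        Complex.normSq (colInner (rotateColumns V p q)) =
      colNormSq V 0 * colNormSq V 1 - Complex.normSq (colInner V) := by
  have hU : (!![p, -star q; q, star p]).det = 1 := by
    rw [← Complex.ofReal_one, ← h]
    simp [Matrix.det_fin_two, Complex.normSq_eq_conj_mul_self]
    ring
  apply Complex.ofReal_injective
  rw [colNormSq_mul_sub_normSq_colInner, colNormSq_mul_sub_normSq_colInner, rotateColumns_eq_mul,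
    Matrix.conjTranspose_mul, Matrix.mul_assoc, ← Matrix.mul_assoc _ V, Matrix.det_mul,
    Matrix.det_mul, Matrix.det_conjTranspose, hU]
  simp

theorem tangleMatrix_rotateColumns (V : Matrix (Fin 2 × Fin 2) (Fin 2) ℂ) (p q : ℂ) :
    tangleMatrix (rotateColumns V p q) =
      (!![p, -star q; q, star p]).transpose * tangleMatrix V * !![p, -star q; q, star p] := by
  rw [rotateColumns_eq_mul, tangleMatrix, tangleMatrix, Matrix.transpose_mul]
  simp only [Matrix.mul_assoc]

theorem det_tangleMatrix_rotateColumns (V : Matrix (Fin 2 × Fin 2) (Fin 2) ℂ) {p q : ℂ}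
    (h : Complex.normSq p + Complex.normSq q = 1) :
    (tangleMatrix (rotateColumns V p q)).det = (tangleMatrix V).det := by
  have hU : (!![p, -star q; q, star p]).det = 1 := by
    rw [← Complex.ofReal_one, ← h]
    simp [Matrix.det_fin_two, Complex.normSq_eq_conj_mul_self]
    ring
  rw [tangleMatrix_rotateColumns, Matrix.det_mul, Matrix.det_mul, Matrix.det_transpose, hU]
  simp

theorem sum_normSq_tangleMatrix_rotateColumns (V : Matrix (Fin 2 × Fin 2) (Fin 2) ℂ) {p q : ℂ}
    (h : Complex.normSq p + Complex.normSq q = 1) :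
    ∑ c, ∑ d, Complex.normSq (tangleMatrix (rotateColumns V p q) c d) =
      ∑ c, ∑ d, Complex.normSq (tangleMatrix V c d) := by
  rw [tangleMatrix_rotateColumns]
  -- Without normalization the matrix is a multiple of a unitary, so this homogeneous form is a
  -- polynomial identity.
  trans (Complex.normSq p + Complex.normSq q) ^ 2 *
    ∑ c, ∑ d, Complex.normSq (tangleMatrix V c d)
  · generalize tangleMatrix V = W
    simp [Matrix.mul_apply, Fin.sum_univ_two, Complex.normSq_apply]
    ring
  · rw [h, one_pow, one_mul]

theorem norm_tangleMatrix_self_le (V : Matrix (Fin 2 × Fin 2) (Fin 2) ℂ) (c : Fin 2) :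
    ‖tangleMatrix V c c‖ ≤ colNormSq V c := by
  have h : tangleMatrix V c c =
      2 * (V (0, 1) c * V (1, 0) c) - 2 * (V (0, 0) c * V (1, 1) c) := by
    rw [tangleMatrix_apply]
    ring
  rw [h]
  refine (norm_sub_le _ _).trans ?_
  simp only [norm_mul, Complex.norm_ofNat, colNormSq, Fintype.sum_prod_type, Fin.sum_univ_two,
    Complex.normSq_eq_norm_sq]
  nlinarith [sq_nonneg (‖V (0, 1) c‖ - ‖V (1, 0) c‖), sq_nonneg (‖V (0, 0) c‖ - ‖V (1, 1) c‖)]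

/-- The sum of the three squared concurrences of a pure three-qubit state is at most `4 / 3`. -/
theorem sum_sq_concurrences_le {V : Matrix (Fin 2 × Fin 2) (Fin 2) ℂ}
    (hV : colNormSq V 0 + colNormSq V 1 = 1) :
    ∑ c, ∑ d, Complex.normSq (tangleMatrix V c d) - 2 * ‖(tangleMatrix V).det‖ +
      4 * (colNormSq V 0 * colNormSq V 1 - Complex.normSq (colInner V)) -
      4 * ‖(tangleMatrix V).det‖ ≤ 4 / 3 := by
  obtain ⟨p, q, h, h0⟩ := exists_tangleMatrix_isotropic V
  rw [← gram_rotateColumns V h, ← det_tangleMatrix_rotateColumns V h,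
    ← sum_normSq_tangleMatrix_rotateColumns V h]
  have hV' := colNormSq_rotateColumns_add V p q
  rw [h, hV, one_mul] at hV'
  have hW : tangleMatrix (rotateColumns V p q) 0 0 = 0 := by
    rw [← h0, tangleMatrix_apply, tangleMatrix_apply, tangleMatrix_apply, tangleMatrix_apply]
    simp [rotateColumns]
    ring
  generalize rotateColumns V p q = U at *
  have hdet : ‖(tangleMatrix U).det‖ = Complex.normSq (tangleMatrix U 0 1) := by
    rw [Matrix.det_fin_two, hW, tangleMatrix_comm U 1 0, zero_mul, zero_sub, norm_neg, norm_mul,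
      Complex.normSq_eq_norm_sq, sq]
  have h1 : Complex.normSq (tangleMatrix U 1 1) ≤ colNormSq U 1 ^ 2 := by
    rw [Complex.normSq_eq_norm_sq]
    exact pow_le_pow_left₀ (norm_nonneg _) (norm_tangleMatrix_self_le U 1) 2
  simp only [hdet, Fin.sum_univ_two, hW, tangleMatrix_comm U 1 0, map_zero]
  have hU : colNormSq U 0 = 1 - colNormSq U 1 := by linarith
  rw [hU]
  -- With `n = colNormSq U 1`, the left side is at most `n² + 4n(1 - n) = 4/3 - (3n - 2)²/3`.
  nlinarith [Complex.normSq_nonneg (colInner U), Complex.normSq_nonneg (tangleMatrix U 0 1),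
    sq_nonneg (3 * colNormSq U 1 - 2)]

/-! ### Orthonormal bases on which a trace-zero form vanishes. -/

/-- A rotation in the plane of two orthonormal vectors makes a quadratic form vanish on one
of them when its values have opposite signs. -/
theorem exists_rotation_eq_zero {E : Type*} [NormedAddCommGroup E] [InnerProductSpace ℝ E]
    (B : LinearMap.BilinForm ℝ E) {x y z : E}
    (h : Orthonormal ℝ ![x, y, z]) (hx : 0 ≤ B x x) (hy : B y y ≤ 0) :
    ∃ x' y', Orthonormal ℝ ![x', y', z] ∧ B x' x' = 0 ∧ B x' x' + B y' y' = B x x + B y y := by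
  have hf : ContinuousOn (fun θ : ℝ => B (Real.cos θ • x + Real.sin θ • y)
      (Real.cos θ • x + Real.sin θ • y)) (Set.Icc 0 (Real.pi / 2)) := by
    simp only [map_add, map_smul, LinearMap.add_apply, LinearMap.smul_apply, smul_eq_mul]
    fun_prop
  obtain ⟨θ, -, hθ⟩ := intermediate_value_Icc' (by positivity) hf
    (show (0 : ℝ) ∈ _ by simpa using ⟨hy, hx⟩)
  refine ⟨_, -Real.sin θ • x + Real.cos θ • y, ?_, hθ, ?_⟩
  · have hxx := h.1 0
    have hyy := h.1 1
    have hzz := h.1 2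
    have hxy := h.2 (show (0 : Fin 3) ≠ 1 by decide)
    have hxz := h.2 (show (0 : Fin 3) ≠ 2 by decide)
    have hyz := h.2 (show (1 : Fin 3) ≠ 2 by decide)
    simp at hxx hyy hzz hxy hxz hyz
    have hyx : ⟪y, x⟫ = 0 := by rw [real_inner_comm, hxy]
    have hzx : ⟪z, x⟫ = 0 := by rw [real_inner_comm, hxz]
    have hzy : ⟪z, y⟫ = 0 := by rw [real_inner_comm, hyz]
    have hcs := Real.sin_sq_add_cos_sq θ
    refine ⟨fun a => ?_, fun a b hab => ?_⟩
    · rw [← sq_eq_sq₀ (norm_nonneg _) zero_le_one, ← real_inner_self_eq_norm_sq]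
      fin_cases a <;>
        simp only [Fin.zero_eta, Fin.mk_one, Fin.reduceFinMk, Matrix.cons_val, inner_add_left,
          inner_add_right, real_inner_smul_left, real_inner_smul_right, hxy, hyx,
          real_inner_self_eq_norm_sq, norm_smul, mul_pow, Real.norm_eq_abs, sq_abs, hxx, hyy,
          hzz] <;>
        linarith
    · fin_cases a <;> fin_cases b <;>
        simp [inner_add_left, inner_add_right, real_inner_smul_left, real_inner_smul_right, hxx,
          hyy, hxy, hxz, hyz, hyx, hzx, hzy] at hab ⊢ <;> ring
  · simp only [map_add, map_smul, LinearMap.add_apply, LinearMap.smul_apply, smul_eq_mul]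
    linear_combination (B x x + B y y) * Real.sin_sq_add_cos_sq θ

/-- A quadratic form of trace zero on a three-dimensional space vanishes on some orthonormal
basis. -/
theorem exists_orthonormal_forall_eq_zero {E : Type*} [NormedAddCommGroup E]
    [InnerProductSpace ℝ E] (B : LinearMap.BilinForm ℝ E) {e : Fin 3 → E}
    (he : Orthonormal ℝ e) (htr : ∑ k, B (e k) (e k) = 0) :
    ∃ b : Fin 3 → E, Orthonormal ℝ b ∧ ∀ k, B (b k) (b k) = 0 := by
  have hstep : ∀ {x y z : E}, Orthonormal ℝ ![x, y, z] → 0 ≤ B x x → B y y ≤ 0 →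
      B x x + B y y + B z z = 0 →
      ∃ b : Fin 3 → E, Orthonormal ℝ b ∧ ∀ k, B (b k) (b k) = 0 := by
    intro x y z h hx hy hs
    obtain ⟨x', y', h', hx', hs'⟩ := exists_rotation_eq_zero B h hx hy
    have key : ∀ {u v w : E}, Orthonormal ℝ ![u, v, w] → 0 ≤ B u u → B v v ≤ 0 → B w w = 0 →
        B u u + B v v + B w w = 0 →
        ∃ b : Fin 3 → E, Orthonormal ℝ b ∧ ∀ k, B (b k) (b k) = 0 := by
      intro u v w h hu hv hw hs
      obtain ⟨u', v', h', hu', hs'⟩ := exists_rotation_eq_zero B h hu hv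
      refine ⟨_, h', fun k => ?_⟩
      fin_cases k <;> simp <;> linarith
    -- The trace is still zero, so `B` has opposite signs on `y'` and `z`; a second rotation in
    -- their plane finishes.
    rcases le_total 0 (B y' y') with hy' | hy'
    · refine key (u := y') (v := z) (w := x') ?_ hy' (by linarith) hx' (by linarith)
      convert h'.comp ![1, 2, 0] (by decide) using 1
      ext k; fin_cases k <;> rfl
    · refine key (u := z) (v := y') (w := x') ?_ (by linarith) hy' hx' (by linarith)
      convert h'.comp ![2, 1, 0] (by decide) using 1
      ext k; fin_cases k <;> rfl
  have hperm : ∀ σ : Fin 3 → Fin 3, Function.Injective σ →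
      Orthonormal ℝ ![e (σ 0), e (σ 1), e (σ 2)] := by
    intro σ hσ
    convert he.comp σ hσ using 1
    ext k; fin_cases k <;> rfl
  rw [Fin.sum_univ_three] at htr
  rcases le_total 0 (B (e 0) (e 0)) with h0 | h0 <;> rcases le_total 0 (B (e 1) (e 1)) with h1 | h1
  · exact hstep (hperm ![0, 2, 1] (by decide)) h0 (by simp; linarith) (by simp; linarith)
  · exact hstep (hperm ![0, 1, 2] (by decide)) h0 h1 (by simp; linarith)
  · exact hstep (hperm ![1, 0, 2] (by decide)) h1 h0 (by simp; linarith)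
  · exact hstep (hperm ![2, 0, 1] (by decide)) (by simp; linarith) h0 (by simp; linarith)

/-! ### From `S > 1` to a violated steering inequality. -/

theorem trace_mul_spin_kronecker_re (ρ : Matrix (Fin 2 × Fin 2) (Fin 2 × Fin 2) ℂ)
    (a b : EuclideanSpace ℝ (Fin 3)) :
    (ρ * (spin a ⊗ₖ spin b)).trace.re = ⟪a, (correlationMatrix ρ).toEuclideanLin b⟫ := by
  have h : ρ * (spin a ⊗ₖ spin b) =
      ∑ k, ∑ l, ((a k * b l : ℝ) : ℂ) • (ρ * (pauli k ⊗ₖ pauli l)) := by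
    simp only [spin, Fin.sum_univ_three, Matrix.add_kronecker, Matrix.kronecker_add,
      Matrix.smul_kronecker, Matrix.kronecker_smul, Matrix.mul_add, Matrix.mul_smul, smul_add,
      Complex.ofReal_mul, mul_smul]
    simp only [smul_comm (b _ : ℂ) (a _ : ℂ)]
    abel
  rw [h]
  simp only [Matrix.trace_sum, Matrix.trace_smul, Complex.re_sum, smul_eq_mul,
    Complex.re_ofReal_mul]
  simp [correlationMatrix, PiLp.inner_apply, Matrix.toLpLin_apply, Matrix.mulVec, dotProduct,
    Fin.sum_univ_three]
  ring

theorem isF3Steerable_of_one_lt_steeringS {ρ : Matrix (Fin 2 × Fin 2) (Fin 2 × Fin 2) ℂ}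
    (hS : 1 < steeringS ρ) : IsF3Steerable ρ := by
  set S := steeringS ρ with hSdef
  let T := (correlationMatrix ρ).toEuclideanLin
  -- The shift `S / 3` makes the trace zero; a null unit vector `x` satisfies `‖T x‖² = S / 3`.
  let B : LinearMap.BilinForm ℝ (EuclideanSpace ℝ (Fin 3)) :=
    (innerₗ _).compl₁₂ T T - (S / 3) • innerₗ _
  have hB : ∀ x, B x x = ‖T x‖ ^ 2 - S / 3 * ‖x‖ ^ 2 := by
    intro x
    simp [B]
  obtain ⟨b, hb, hb0⟩ := exists_orthonormal_forall_eq_zero B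
    (EuclideanSpace.basisFun (Fin 3) ℝ).orthonormal (by
      simp only [hB, OrthonormalBasis.norm_eq_one]
      simp [T, EuclideanSpace.norm_sq_eq, hSdef, steeringS, Matrix.trace, Matrix.mul_apply,
        Fin.sum_univ_three]
      ring)
  have hT : ∀ k, ‖T (b k)‖ = √(S / 3) := by
    intro k
    have := hb0 k
    rw [hB, hb.1 k] at this
    rw [← Real.sqrt_sq (norm_nonneg (T (b k)))]
    congr 1
    linarith
  have hpos : 0 < √(S / 3) := Real.sqrt_pos.2 (by linarith)
  refine ⟨fun k => (√(S / 3))⁻¹ • T (b k), b, fun k => ?_, hb, ?_⟩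
  · rw [norm_smul, hT, norm_inv, Real.norm_of_nonneg hpos.le, inv_mul_cancel₀ hpos.ne']
  · have hsum : 3 * √(S / 3) ≤
        ‖∑ k, (ρ * (spin ((√(S / 3))⁻¹ • T (b k)) ⊗ₖ spin (b k))).trace‖ := by
      refine le_trans (le_of_eq ?_) (Complex.re_le_norm _)
      simp only [Complex.re_sum, trace_mul_spin_kronecker_re]
      have : ∀ k, ⟪(√(S / 3))⁻¹ • T (b k), (correlationMatrix ρ).toEuclideanLin (b k)⟫ =
          √(S / 3) := by
        intro k
        change ⟪(√(S / 3))⁻¹ • T (b k), T (b k)⟫ = _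
        rw [real_inner_smul_left, real_inner_self_eq_norm_sq, hT]
        field_simp
      rw [Finset.sum_congr rfl fun k _ => this k]
      simp
    have h3 : (0 : ℝ) < √3 := by positivity
    have : 1 < √S := Real.lt_sqrt_of_sq_lt (by simpa)
    have hs : √(S / 3) * √3 = √S := by
      rw [Real.sqrt_div (by linarith)]
      field_simp
    rw [steeringF, one_div, Nat.cast_ofNat, inv_mul_eq_div, lt_div_iff₀ h3]
    nlinarith [Real.sq_sqrt (show (0 : ℝ) ≤ 3 by norm_num)]

theorem theorem3 (ψ : EuclideanSpace ℂ (Fin 3 → Fin 2)) (hψ : ‖ψ‖ = 1)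
    (i j : Fin 3) (hij : i ≠ j)
    (hC : (4 / 9 : ℝ) < concurrence (reducedState (pureDensity ψ) i j) ^ 2) :
    IsF3Steerable (reducedState (pureDensity ψ) i j) ∧
      1 < steeringS (reducedState (pureDensity ψ) i j) := by
  suffices hS : 1 < steeringS (reducedState (pureDensity ψ) i j) from
    ⟨isF3Steerable_of_one_lt_steeringS hS, hS⟩
  have hV := sum_colNormSq_basisLabel ψ hψ hij
  rw [reducedState_pureDensity] at hC ⊢
  rw [concurrence_mul_conjTranspose_sq] at hC
  have h1 := steeringS_mul_conjTranspose (Matrix.of fun x c => ψ (basisLabel i j x c))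
  have h2 := sum_sq_concurrences_le hV
  rw [hV] at h1
  -- `S = 1 + 2t - 4G`, and `4G ≤ 4/3 - t + 6δ` gives `S ≥ 3(t - 2δ) - 1/3`; the threshold `4/9`
  -- makes this exceed `1`.
  linarith
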